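/- Let $2^\omega$ denote the Cantor group $(\mathbb Z/2\mathbb Z)^{\mathbb N}$ with the product topology. For a locally compact Polish group $G$ with left Haar measure $\mu$ (a left-invariant Borel measure that is positive on non-empty open sets and finite on compact sets; it is unique up to a positive factor, and it is identified with its completion), consider the following condition: (R) for every $F_\sigma$ set $H\subseteq G\times G$, if there are arbitrary (not necessarily measurable) sets $C,D\subseteq G$ such that $C\times D\subseteq H$ and $C\times D$ is not a $\mu\times\mu$-null set, then there are $\mu$-measurable sets $A,B\subseteq G$ with $A\times B\subseteq H$ and $(\mu\times\mu)(A\times B)>0$. Assume that (R) holds for $G=2^\omega$ with its Haar measure. Then (R) holds for every non-discrete locally compact Polish group $G$. -/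

import Mathlib

open MeasureTheory MeasureTheory.Measure Set

/-- `s` is an `F_σ` set: a countable union of closed sets. -/
def IsFSigma {X : Type*} [TopologicalSpace X] (s : Set X) : Prop :=
  ∃ F : ℕ → Set X, (∀ n, IsClosed (F n)) ∧ s = ⋃ n, F n

/-- The rectangle property of a measure `μ` on `X`: every `F_σ` subset `H` of `X × X` that contains
a rectangle `C × D` which is not `μ × μ`-null contains a measurable rectangle `A × B` of positive
`μ × μ`-measure.

The sets `C` and `D` are arbitrary; `μ.prod μ` of a non-measurable set is its outer measure, so that
`≠ 0` says that the set is not covered by a measurable null set. Measurability of `A` and `B` is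
meant with respect to the completion of `μ`. -/
def RectangleProperty {X : Type*} [TopologicalSpace X] [MeasurableSpace X] (μ : Measure X) : Prop :=
  ∀ H : Set (X × X), IsFSigma H →
    (∃ C D : Set X, C ×ˢ D ⊆ H ∧ (μ.prod μ) (C ×ˢ D) ≠ 0) →
    ∃ A B : Set X, NullMeasurableSet A μ ∧ NullMeasurableSet B μ ∧
      A ×ˢ B ⊆ H ∧ 0 < (μ.prod μ) (A ×ˢ B)

/-- The Cantor group `2^ω`: the product of countably many copies of the discrete group `ℤ/2ℤ`, with
coordinatewise addition and the product topology. -/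
abbrev CantorGroup : Type := ℕ → ZMod 2

open ProbabilityTheory Filter Topology

/-- The distribution function of an atomless probability measure on `ℝ` is continuous. -/
theorem continuous_cdf (m : Measure ℝ) [IsProbabilityMeasure m] [NullSingletonClass m] :
    Continuous (cdf m) := by
  refine continuous_iff_continuousAt.2 fun a => ?_
  rw [(monotone_cdf m).continuousAt_iff_leftLim_eq_rightLim, (cdf m).rightLim_eq]
  have h : (cdf m).measure {a} = 0 := by rw [measure_cdf, measure_singleton]
  rw [StieltjesFunction.measure_singleton, ENNReal.ofReal_eq_zero] at h
  exact le_antisymm ((monotone_cdf m).leftLim_le le_rfl) (by linarith)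

/-- The probability integral transform: an atomless probability measure on `ℝ` is pushed forward by
its distribution function to the uniform distribution on the unit interval. -/
theorem map_cdf (m : Measure ℝ) [IsProbabilityMeasure m] [NullSingletonClass m] :
    m.map (cdf m) = volume.restrict (Icc (0 : ℝ) 1) := by
  have hc := continuous_cdf m
  have hmono := monotone_cdf m
  have hivt : ∀ t ∈ Ioo (0 : ℝ) 1, ∃ a, cdf m a = t := fun t ht => by
    obtain ⟨a, ha⟩ := ((tendsto_cdf_atBot m).eventually_lt_const ht.1).exists
    obtain ⟨b, hb⟩ := ((tendsto_cdf_atTop m).eventually_const_lt ht.2).exists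
    exact mem_range_of_exists_le_of_exists_ge hc ⟨a, ha.le⟩ ⟨b, hb.le⟩
  have : IsProbabilityMeasure (m.map (cdf m)) :=
    Measure.isProbabilityMeasure_map hc.measurable.aemeasurable
  refine Measure.ext_of_Iic _ _ fun t => ?_
  rw [Measure.map_apply hc.measurable measurableSet_Iic, Measure.restrict_apply measurableSet_Iic]
  rcases lt_or_ge t 0 with ht0 | ht0
  · have h1 : cdf m ⁻¹' Iic t = ∅ := by
      ext x; simpa using ht0.trans_le (cdf_nonneg m x)
    have h2 : Iic t ∩ Icc (0 : ℝ) 1 = ∅ := by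
      ext x; simp only [mem_inter_iff, mem_Iic, mem_Icc, mem_empty_iff_false, iff_false]
      intro h; linarith [h.1, h.2.1]
    rw [h1, h2, measure_empty, measure_empty]
  rcases le_or_gt 1 t with ht1 | ht1
  · have h1 : cdf m ⁻¹' Iic t = univ := by
      ext x; simpa using (cdf_le_one m x).trans ht1
    have h2 : Iic t ∩ Icc (0 : ℝ) 1 = Icc 0 1 :=
      inter_eq_right.2 fun x hx => hx.2.trans ht1
    rw [h1, h2, measure_univ, Real.volume_Icc]; simp
  have h2 : Iic t ∩ Icc (0 : ℝ) 1 = Icc 0 t := by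
    ext x; simp only [mem_inter_iff, mem_Iic, mem_Icc]
    exact ⟨fun h => ⟨h.2.1, h.1⟩, fun h => ⟨h.2, h.1, h.2.trans ht1.le⟩⟩
  rw [h2, Real.volume_Icc, sub_zero]
  apply le_antisymm
  · have hle : ∀ s ∈ Ioo t 1, m (cdf m ⁻¹' Iic t) ≤ ENNReal.ofReal s := fun s hs => by
      obtain ⟨a, ha⟩ := hivt s ⟨ht0.trans_lt hs.1, hs.2⟩
      rw [← ha, ofReal_cdf]
      refine measure_mono fun x hx => ?_
      by_contra hxa
      have := hmono (not_le.1 hxa).le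
      exact absurd (lt_of_le_of_lt hx hs.1) (by rw [← ha]; exact not_lt.2 this)
    refine ge_of_tendsto (x := 𝓝[>] t)
      ((ENNReal.continuous_ofReal.tendsto t).mono_left nhdsWithin_le_nhds) ?_
    filter_upwards [Ioo_mem_nhdsGT ht1] with s hs using hle s hs
  · rcases ht0.eq_or_lt with rfl | ht0
    · simp
    obtain ⟨a, ha⟩ := hivt t ⟨ht0, ht1⟩
    rw [← ha, ofReal_cdf]
    exact measure_mono fun x hx => hmono hx

/-- An atomless probability measure on a standard Borel space is transported to the uniform
distribution on the unit interval by a measurable map that is injective up to a null set. -/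
theorem exists_map_eq_volume_restrict_Icc {X : Type*} [MeasurableSpace X] [StandardBorelSpace X]
    (μ : Measure X) [IsProbabilityMeasure μ] [NullSingletonClass μ] :
    ∃ (φ : X → ℝ) (E : Set X), Measurable φ ∧ MeasurableSet E ∧ μ Eᶜ = 0 ∧
      (∀ x ∈ E, ∀ y, φ x = φ y → x = y) ∧ μ.map φ = volume.restrict (Icc (0 : ℝ) 1) := by
  have he := measurableEmbedding_embeddingReal X
  let m := μ.map (embeddingReal X)
  have : IsProbabilityMeasure m := Measure.isProbabilityMeasure_map he.measurable.aemeasurable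
  have : NullSingletonClass m := ⟨fun t => by
    rw [he.map_apply]
    exact (subsingleton_singleton.preimage he.injective).measure_zero μ⟩
  have hF : Measurable (cdf m) := (continuous_cdf m).measurable
  let T : Set ℝ := {c | ∃ x y, x < y ∧ cdf m x = c ∧ cdf m y = c}
  have hT : T.Countable := (monotone_cdf m).countable_setOfPred_two_preimages
  have hφ : Measurable (cdf m ∘ embeddingReal X) := hF.comp he.measurable
  have hmap : μ.map (cdf m ∘ embeddingReal X) = volume.restrict (Icc (0 : ℝ) 1) := by
    rw [← Measure.map_map hF he.measurable]
    exact map_cdf m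
  refine ⟨cdf m ∘ embeddingReal X, (cdf m ∘ embeddingReal X) ⁻¹' Tᶜ, hφ,
    hφ hT.measurableSet.compl, ?_, ?_, hmap⟩
  · rw [← preimage_compl, compl_compl, ← Measure.map_apply hφ hT.measurableSet, hmap]
    exact hT.measure_zero _
  · intro x hx y hxy
    by_contra hne
    rcases lt_or_gt_of_ne (he.injective.ne hne) with h | h
    · exact hx ⟨_, _, h, rfl, hxy.symm⟩
    · exact hx ⟨_, _, h, hxy.symm, rfl⟩

/-- A compact set is compact in every coarser topology. -/
theorem IsCompact.of_topology_le {X : Type*} {t t' : TopologicalSpace X} (h : t' ≤ t) {K : Set X}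
    (hK : @IsCompact X t' K) : @IsCompact X t K := by
  simpa using @IsCompact.image X X t' t K id hK (continuous_id_of_le h)

/-- Lusin's theorem for finite measures on Polish spaces. -/
theorem exists_isCompact_continuousOn_measure_sdiff_lt {X Z : Type*} [t : TopologicalSpace X]
    [PolishSpace X] [MeasurableSpace X] [hX : BorelSpace X] [TopologicalSpace Z]
    [SecondCountableTopology Z] [MeasurableSpace Z] [OpensMeasurableSpace Z]
    (μ : Measure X) [IsFiniteMeasure μ] {φ : X → Z} (hφ : Measurable φ) {E : Set X}
    (hE : MeasurableSet E) {ε : ENNReal} (hε : ε ≠ 0) :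
    ∃ K ⊆ E, IsCompact K ∧ ContinuousOn φ K ∧ μ (E \ K) < ε := by
  have hpolish : PolishSpace X := inferInstance
  have hT2 : T2Space X := inferInstance
  obtain ⟨t', ht', hcont, hpol⟩ := hφ.exists_continuous
  have hb : @BorelSpace X t' _ :=
    @BorelSpace.mk X t' _ (hX.measurable_eq.trans (borel_eq_borel_of_le hpol hpolish ht').symm)
  obtain ⟨K, hKE, hK, hlt⟩ := @MeasurableSet.exists_isCompact_sdiff_lt X _ μ t' inferInstance
    inferInstance inferInstance E hE (measure_ne_top μ E) ε hε
  refine ⟨K, hKE, hK.of_topology_le ht', ?_, hlt⟩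
  refine (@continuousOn_iff_isClosed X Z t _ φ K).2 fun s hs => ⟨φ ⁻¹' s ∩ K, ?_, by simp⟩
  have hcl : @IsCompact X t' (φ ⁻¹' s ∩ K) :=
    @IsCompact.inter_left X t' _ _ hK (@IsClosed.preimage X Z t' _ φ hcont s hs)
  exact @IsCompact.isClosed X t hT2 _ (hcl.of_topology_le ht')

/-- The rectangle property depends only on the null sets of the measure. -/
theorem RectangleProperty.of_absolutelyContinuous {X : Type*} [TopologicalSpace X]
    [MeasurableSpace X] {μ ν : Measure X} [SFinite μ] [SFinite ν] (hμν : μ ≪ ν) (hνμ : ν ≪ μ)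
    (h : RectangleProperty μ) : RectangleProperty ν := by
  rintro H hH ⟨C, D, hCD, h0⟩
  obtain ⟨A, B, hA, hB, hAB, hpos⟩ := h H hH ⟨C, D, hCD, fun h0' => h0 ((hνμ.prod hνμ) h0')⟩
  exact ⟨A, B, hA.mono_ac hνμ, hB.mono_ac hνμ, hAB,
    pos_iff_ne_zero.2 fun h0' => hpos.ne' ((hμν.prod hμν) h0')⟩

/-- The rectangle property passes from one atomless probability measure on a Polish space to any
other. -/
theorem RectangleProperty.of_isProbabilityMeasure {X Y : Type*}
    [TopologicalSpace X] [PolishSpace X] [MeasurableSpace X] [BorelSpace X]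
    [TopologicalSpace Y] [PolishSpace Y] [MeasurableSpace Y] [BorelSpace Y]
    (μ : Measure X) [IsProbabilityMeasure μ] [NullSingletonClass μ]
    (ν : Measure Y) [IsProbabilityMeasure ν] [NullSingletonClass ν]
    (hν : RectangleProperty ν) : RectangleProperty μ := by
  obtain ⟨φ, E, hφ, hE, hE0, hφE, hφmap⟩ := exists_map_eq_volume_restrict_Icc μ
  obtain ⟨ψ, E', hψ, hE', hE'0, hψE, hψmap⟩ := exists_map_eq_volume_restrict_Icc ν
  have hmap : ∀ S : Set ℝ, MeasurableSet S → μ (φ ⁻¹' S) = ν (ψ ⁻¹' S) := fun S hS => by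
    rw [← Measure.map_apply hφ hS, ← Measure.map_apply hψ hS, hφmap, hψmap]
  rintro H ⟨F, hF, rfl⟩ ⟨C, D, hCD, h0⟩
  rw [Measure.prod_prod, mul_ne_zero_iff] at h0
  obtain ⟨ε, hε0, hεC, hεD⟩ : ∃ ε : ENNReal, ε ≠ 0 ∧ ε + ε ≤ μ C ∧ ε + ε ≤ μ D := by
    refine ⟨min (μ C) (μ D) / 2, ?_, ?_, ?_⟩
    · rw [ENNReal.div_ne_zero]
      exact ⟨by simpa using h0, by simp⟩
    · rw [ENNReal.add_halves]; exact min_le_left _ _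
    · rw [ENNReal.add_halves]; exact min_le_right _ _
  obtain ⟨K, hKE, hK, hφK, hKε⟩ := exists_isCompact_continuousOn_measure_sdiff_lt μ hφ hE hε0
  obtain ⟨M, hME, hM, hψM, hMε⟩ := exists_isCompact_continuousOn_measure_sdiff_lt ν hψ hE' hε0
  have hKc : μ Kᶜ < ε := by
    refine lt_of_le_of_lt ((measure_mono ?_).trans (measure_union_le (E \ K) Eᶜ)) (by simpa [hE0])
    intro x hx
    by_cases h : x ∈ E
    · exact Or.inl ⟨h, hx⟩
    · exact Or.inr h
  have hMc : ν Mᶜ < ε := by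
    refine lt_of_le_of_lt ((measure_mono ?_).trans (measure_union_le (E' \ M) E'ᶜ)) (by simpa [hE'0])
    intro x hx
    by_cases h : x ∈ E'
    · exact Or.inl ⟨h, hx⟩
    · exact Or.inr h
  have hφinj : InjOn φ K := fun x hx y _ hxy => hφE x (hKE hx) y hxy
  have hψinj : InjOn ψ M := fun x hx y _ hxy => hψE x (hME hx) y hxy
  -- Sets of large outer measure are sent to sets of positive outer measure.
  have htransfer : ∀ C : Set X, ε + ε ≤ μ C → ν (M ∩ ψ ⁻¹' (φ '' (C ∩ K))) ≠ 0 := by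
    intro C hC hnull
    obtain ⟨N, hN, hNm, hN0⟩ := exists_measurable_superset_of_null hnull
    have hNM : MeasurableSet (ψ '' (N ∩ M)) :=
      (hNm.inter hM.measurableSet).image_of_measurable_injOn hψ (hψinj.mono inter_subset_right)
    have hMm : MeasurableSet (ψ '' M) := hM.measurableSet.image_of_measurable_injOn hψ hψinj
    have hsub : C ⊆ (φ ⁻¹' (ψ '' (N ∩ M)) ∪ φ ⁻¹' (ψ '' M)ᶜ) ∪ Kᶜ := by
      intro x hx
      by_cases hxK : x ∈ K
      · refine Or.inl ?_
        by_cases hxM : φ x ∈ ψ '' M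
        · obtain ⟨u, hu, hux⟩ := hxM
          exact Or.inl ⟨u, ⟨hN ⟨hu, x, ⟨hx, hxK⟩, hux.symm⟩, hu⟩, hux⟩
        · exact Or.inr hxM
      · exact Or.inr hxK
    have h1 : μ (φ ⁻¹' (ψ '' (N ∩ M))) = 0 := by
      rw [hmap _ hNM]
      refine measure_mono_null ?_ hN0
      rintro y ⟨u, hu, huy⟩
      rw [← hψE u (hME hu.2) y huy]
      exact hu.1
    have h2 : μ (φ ⁻¹' (ψ '' M)ᶜ) < ε := by
      rw [hmap _ hMm.compl]
      have hsub' : ψ ⁻¹' (ψ '' M)ᶜ ⊆ Mᶜ := fun y hy hyM => hy ⟨y, hyM, rfl⟩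
      exact (measure_mono hsub').trans_lt hMc
    have h3 : μ C < ε + ε := by
      calc μ C ≤ μ (φ ⁻¹' (ψ '' (N ∩ M))) + μ (φ ⁻¹' (ψ '' M)ᶜ) + μ Kᶜ :=
            (measure_mono hsub).trans ((measure_union_le _ _).trans
              (add_le_add_left (measure_union_le _ _) _))
        _ < ε + ε := by rw [h1, zero_add]; exact ENNReal.add_lt_add h2 hKc
    exact absurd hC (not_le.2 h3)
  -- Measurable sets of positive measure are pulled back to measurable sets of positive measure.
  have hpull : ∀ A : Set Y, NullMeasurableSet A ν → ν A ≠ 0 → (∀ u ∈ A, ψ u ∈ φ '' K) →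
      A ⊆ M → ∃ B : Set X, MeasurableSet B ∧ μ B ≠ 0 ∧ B ⊆ K ∩ φ ⁻¹' (ψ '' A) := by
    intro A hA hA0 hAK hAM
    obtain ⟨A', hA'A, hA', hae⟩ := hA.exists_measurable_subset_ae_eq
    have hm : MeasurableSet (ψ '' A') :=
      hA'.image_of_measurable_injOn hψ (hψinj.mono (hA'A.trans hAM))
    refine ⟨φ ⁻¹' (ψ '' A'), hφ hm, ?_, ?_⟩
    · rw [hmap _ hm]
      intro h
      exact hA0 (by rw [← measure_congr hae]; exact measure_mono_null (subset_preimage_image ψ A') h)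
    · rintro x ⟨u, hu, hux⟩
      obtain ⟨k, hk, hku⟩ := hAK u (hA'A hu)
      have : k = x := hφE k (hKE hk) x (hku.trans hux)
      exact ⟨this ▸ hk, u, hA'A hu, hux⟩
  let Φ : X × X → ℝ × ℝ := Prod.map φ φ
  let Ψ : Y × Y → ℝ × ℝ := Prod.map ψ ψ
  let H' : Set (Y × Y) := ⋃ n, (M ×ˢ M) ∩ Ψ ⁻¹' (Φ '' (F n ∩ K ×ˢ K))
  have hH' : IsFSigma H' := by
    refine ⟨_, fun n => ?_, rfl⟩
    have hcpt : IsCompact (Φ '' (F n ∩ K ×ˢ K)) :=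
      ((hK.prod hK).inter_left (hF n)).image_of_continuousOn
        ((hφK.prodMap hφK).mono inter_subset_right)
    exact (hψM.prodMap hψM).preimage_isClosed_of_isClosed (hM.prod hM).isClosed hcpt.isClosed
  obtain ⟨A, B, hA, hB, hAB, hpos⟩ := hν H' hH' ⟨M ∩ ψ ⁻¹' (φ '' (C ∩ K)),
    M ∩ ψ ⁻¹' (φ '' (D ∩ K)), by
      rintro ⟨u, v⟩ ⟨⟨hu, x, hx, hxu⟩, ⟨hv, y, hy, hyv⟩⟩
      obtain ⟨n, hn⟩ := mem_iUnion.1 (hCD (show (x, y) ∈ C ×ˢ D from ⟨hx.1, hy.1⟩))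
      exact mem_iUnion.2 ⟨n, ⟨hu, hv⟩, (x, y), ⟨hn, hx.2, hy.2⟩, Prod.ext hxu hyv⟩,
    by
      rw [Measure.prod_prod]
      exact mul_ne_zero (htransfer C hεC) (htransfer D hεD)⟩
  rw [Measure.prod_prod, pos_iff_ne_zero, mul_ne_zero_iff] at hpos
  have hmem : ∀ u ∈ A, ∀ v ∈ B, (u ∈ M ∧ v ∈ M) ∧
      ∃ x ∈ K, ∃ y ∈ K, (x, y) ∈ ⋃ n, F n ∧ φ x = ψ u ∧ φ y = ψ v := by
    intro u hu v hv
    obtain ⟨n, hM', ⟨x, y⟩, ⟨hn, hx, hy⟩, hxy⟩ :=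
      mem_iUnion.1 (hAB (show (u, v) ∈ A ×ˢ B from ⟨hu, hv⟩))
    exact ⟨hM', x, hx, y, hy, mem_iUnion.2 ⟨n, hn⟩, congrArg Prod.fst hxy, congrArg Prod.snd hxy⟩
  obtain ⟨a, ha⟩ := nonempty_of_measure_ne_zero hpos.1
  obtain ⟨b, hb⟩ := nonempty_of_measure_ne_zero hpos.2
  obtain ⟨A', hA', hA'0, hA'K⟩ := hpull A hA hpos.1
    (fun u hu => by
      obtain ⟨-, x, hx, -, -, -, h, -⟩ := hmem u hu b hb
      exact ⟨x, hx, h⟩)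
    (fun u hu => (hmem u hu b hb).1.1)
  obtain ⟨B', hB', hB'0, hB'K⟩ := hpull B hB hpos.2
    (fun v hv => by
      obtain ⟨-, -, -, y, hy, -, -, h⟩ := hmem a ha v hv
      exact ⟨y, hy, h⟩)
    (fun v hv => (hmem a ha v hv).1.2)
  refine ⟨A', B', hA'.nullMeasurableSet, hB'.nullMeasurableSet, ?_, ?_⟩
  · rintro ⟨x, y⟩ ⟨hx, hy⟩
    obtain ⟨hxK, u, hu, hux⟩ := hA'K hx
    obtain ⟨hyK, v, hv, hvy⟩ := hB'K hy
    obtain ⟨-, x', hx', y', hy', hxy, h1, h2⟩ := hmem u hu v hv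
    rwa [hφinj hx' hxK (h1.trans hux), hφinj hy' hyK (h2.trans hvy)] at hxy
  · rw [Measure.prod_prod, pos_iff_ne_zero]
    exact mul_ne_zero hA'0 hB'0

/-- The rectangle property passes from one nonzero atomless s-finite measure on a Polish space to
any other such measure. -/
theorem RectangleProperty.of_nullSingletonClass {X Y : Type*}
    [TopologicalSpace X] [PolishSpace X] [MeasurableSpace X] [BorelSpace X]
    [TopologicalSpace Y] [PolishSpace Y] [MeasurableSpace Y] [BorelSpace Y]
    (μ : Measure X) [SFinite μ] [NeZero μ] [NullSingletonClass μ]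
    (ν : Measure Y) [SFinite ν] [NeZero ν] [NullSingletonClass ν]
    (hν : RectangleProperty ν) : RectangleProperty μ := by
  have : NullSingletonClass μ.toFinite :=
    ⟨fun x => toFinite_apply_eq_zero_iff.2 (measure_singleton x)⟩
  have : NullSingletonClass ν.toFinite :=
    ⟨fun x => toFinite_apply_eq_zero_iff.2 (measure_singleton x)⟩
  refine .of_absolutelyContinuous (toFinite_absolutelyContinuous μ)
    (absolutelyContinuous_toFinite μ) (.of_isProbabilityMeasure μ.toFinite ν.toFinite ?_)
  exact hν.of_absolutelyContinuous (absolutelyContinuous_toFinite ν)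
    (toFinite_absolutelyContinuous ν)

@[to_additive]
theorem neBot_nhdsNE_one_of_not_discreteTopology {G : Type*} [Group G] [TopologicalSpace G]
    [IsTopologicalGroup G] (hG : ¬ DiscreteTopology G) : (𝓝[≠] (1 : G)).NeBot := by
  rw [discreteTopology_iff_isOpen_singleton_one, isOpen_singleton_iff_punctured_nhds] at hG
  exact ⟨hG⟩

theorem CantorGroup.not_discreteTopology : ¬ DiscreteTopology CantorGroup := fun _ =>
  not_finite_iff_infinite.2 (inferInstance : Infinite CantorGroup) finite_of_compact_of_discrete

instance CantorGroup.polishSpace : PolishSpace CantorGroup :=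
  have : PolishSpace (ZMod 2) := inferInstance
  inferInstanceAs (PolishSpace (ℕ → ZMod 2))

theorem mainTheorem4
    (ν : Measure CantorGroup) [ν.IsAddHaarMeasure] (hν : RectangleProperty ν)
    {G : Type*} [Group G] [TopologicalSpace G] [IsTopologicalGroup G]
    [LocallyCompactSpace G] [PolishSpace G] (hG : ¬ DiscreteTopology G)
    [MeasurableSpace G] [BorelSpace G] (μ : Measure G) [μ.IsHaarMeasure] :
    RectangleProperty μ := by
  have := neBot_nhdsNE_one_of_not_discreteTopology hG
  have := neBot_nhdsNE_zero_of_not_discreteTopology CantorGroup.not_discreteTopology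
  have : NullSingletonClass μ := IsHaarMeasure.nullSingletonClass μ
  have : NullSingletonClass ν := IsAddHaarMeasure.nullSingletonClass ν
  exact .of_nullSingletonClass μ ν hν
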